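/- Let $\mathbb{H}$ be the skew field of quaternions with Euclidean norm $|\cdot|$, let $\mathbb{S}=\{I\in\mathbb{H}: I^2=-1\}$ and, for $I\in\mathbb{S}$, let $L_I=\mathbb{R}+I\mathbb{R}$. For $p,q\in\mathbb{H}$ put $\sigma(q,p)=|q-p|$ if $p$ and $q$ lie on a common line $L_I$, and $$\sigma(q,p)=\sqrt{[\mathrm{Re}(q)-\mathrm{Re}(p)]^2+[|\mathrm{Im}(q)|+|\mathrm{Im}(p)|]^2}$$ otherwise. The map $\sigma$ is a distance on $\mathbb{H}$; let $\partial_\sigma T$ be the boundary of a set $T\subseteq\mathbb{H}$ in the topology induced by $\sigma$, let $\sigma(p,T)=\inf_{b\in T}\sigma(p,b)$ (with $\sigma(p,\emptyset)=+\infty$), and let $$\mathcal{A}(T)=\{p\in T: 2|\mathrm{Im}(p)|<\sigma(p,\partial_\sigma T)\}.$$ Let $\Omega\subseteq\mathbb{H}$ be a domain, i.e. a nonempty connected open set in the Euclidean topology. A function $f:\Omega\to\mathbb{H}$ is called regular if, for every $I\in\mathbb{S}$, the function $(x,y)\mapsto f(x+Iy)$ is real differentiable and satisfies $\frac12\left(\frac{\partial}{\partial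 x}+I\frac{\partial}{\partial y}\right)f(x+Iy)=0$ at all $(x,y)\in\mathbb{R}^2$ with $x+Iy\in\Omega$. Let $(q-p)^{*n}$ be the value at $q$ of the $n$-th power of the polynomial $q-p$ with respect to the regular product $\left(\sum_n q^na_n\right)*\left(\sum_n q^nb_n\right)=\sum_n q^n\sum_{k=0}^n a_kb_{n-k}$ of polynomials with quaternionic coefficients. The function $f$ is called quaternionic analytic at $p\in\Omega$ if there are a Euclidean neighborhood $U\subseteq\Omega$ of $p$ and a sequence $(a_n)_{n\in\mathbb{N}}$ in $\mathbb{H}$ such that, for all $q\in U$, the series $\sum_{n\in\mathbb{N}}(q-p)^{*n}a_n$ converges (absolutely) and its sum is $f(q)$. Then every regular function $f:\Omega\to\mathbb{H}$ is quaternionic analytic at every point of $\mathcal{A}(\Omega)$. -/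

import Mathlib

open scoped Quaternion Topology ENNReal Polynomial

noncomputable section

namespace SliceRegular

/-- The sphere `𝕊` of quaternionic imaginary units. -/
def imUnits : Set ℍ[ℝ] := {I | I ^ 2 = -1}

/-- The point `x + I y`. -/
def slicePt (I : ℍ[ℝ]) (x y : ℝ) : ℍ[ℝ] := (x : ℍ[ℝ]) + I * (y : ℍ[ℝ])

/-- The complex line `L_I = ℝ + I ℝ`. -/
def complexLine (I : ℍ[ℝ]) : Set ℍ[ℝ] := {q | ∃ x y : ℝ, q = slicePt I x y}

/-- `p` and `q` lie on the same complex line `L_I`, for some `I ∈ 𝕊`. -/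
def SameLine (q p : ℍ[ℝ]) : Prop :=
  ∃ I ∈ imUnits, q ∈ complexLine I ∧ p ∈ complexLine I

/-- `ω(q,p) = √([Re q - Re p]² + [|Im q| + |Im p|]²)`. -/
def omegaDist (q p : ℍ[ℝ]) : ℝ :=
  Real.sqrt ((q.re - p.re) ^ 2 + (‖q.im‖ + ‖p.im‖) ^ 2)

open Classical in
/-- The distance `σ`: `|q - p|` on a common complex line, `ω(q,p)` otherwise. -/
def sigmaDist (q p : ℍ[ℝ]) : ℝ :=
  if SameLine q p then ‖q - p‖ else omegaDist q p

/-- The ball `Σ(p,R) = {q : σ(q,p) < R}`. -/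
def sigmaBall (p : ℍ[ℝ]) (R : ℝ) : Set ℍ[ℝ] := {q | sigmaDist q p < R}

/-- The topology induced by `σ`: a set is open when it contains, with each of its points, a
`σ`-ball of positive radius centred there. -/
@[reducible] def sigmaTopology : TopologicalSpace ℍ[ℝ] where
  IsOpen U := ∀ p ∈ U, ∃ ε > 0, sigmaBall p ε ⊆ U
  isOpen_univ := fun _ _ => ⟨1, one_pos, Set.subset_univ _⟩
  isOpen_inter := by
    rintro U V hU hV p ⟨hpU, hpV⟩
    obtain ⟨ε, hε, h1⟩ := hU p hpU
    obtain ⟨δ, hδ, h2⟩ := hV p hpV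
    refine ⟨min ε δ, lt_min hε hδ, fun q hq => ?_⟩
    have hq' : sigmaDist q p < min ε δ := hq
    exact ⟨h1 (lt_min_iff.1 hq').1, h2 (lt_min_iff.1 hq').2⟩
  isOpen_sUnion := by
    intro S hS p hp
    obtain ⟨U, hU, hpU⟩ := hp
    obtain ⟨ε, hε, h⟩ := hS U hU p hpU
    exact ⟨ε, hε, fun q hq => ⟨U, hU, h hq⟩⟩

/-- The boundary `∂_σ T` in the `σ`-topology. -/
def sigmaBoundary (T : Set ℍ[ℝ]) : Set ℍ[ℝ] := @frontier ℍ[ℝ] sigmaTopology T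

/-- The distance `σ(p,T) = inf {σ(p,b) : b ∈ T}` to a set, equal to `+∞` when `T` is empty. -/
def sigmaDistSet (p : ℍ[ℝ]) (T : Set ℍ[ℝ]) : ℝ≥0∞ :=
  ⨅ b ∈ T, ENNReal.ofReal (sigmaDist p b)

/-- `𝓐(T) = {p ∈ T : 2 |Im p| < σ(p, ∂_σ T)}`. -/
def analyticitySet (T : Set ℍ[ℝ]) : Set ℍ[ℝ] :=
  {p | p ∈ T ∧ ENNReal.ofReal (2 * ‖p.im‖) < sigmaDistSet p (sigmaBoundary T)}

/-- `∂̄_I f (x + I y) = ½ (∂/∂x + I ∂/∂y) f_I (x + I y)`. -/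
def dbar (I : ℍ[ℝ]) (f : ℍ[ℝ] → ℍ[ℝ]) (x y : ℝ) : ℍ[ℝ] :=
  (1 / 2 : ℝ) • (deriv (fun t : ℝ => f (slicePt I t y)) x
    + I * deriv (fun t : ℝ => f (slicePt I x t)) y)

/-- `f` is slice regular on `Ω`: for every `I ∈ 𝕊` the restriction `f_I` to `Ω ∩ L_I` is
holomorphic, i.e. it is (real) differentiable in `(x, y)` and `∂̄_I f` vanishes on `Ω ∩ L_I`.
Only the values of `f` on `Ω` matter when `Ω` is open. -/
def IsRegularOn (f : ℍ[ℝ] → ℍ[ℝ]) (Ω : Set ℍ[ℝ]) : Prop :=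
  ∀ I ∈ imUnits, ∀ x y : ℝ, slicePt I x y ∈ Ω →
    DifferentiableAt ℝ (fun z : ℝ × ℝ => f (slicePt I z.1 z.2)) (x, y) ∧ dbar I f x y = 0

/-- The value at `q` of the regular polynomial `∑ qⁿ aₙ` (coefficients on the right). -/
def regEval (P : ℍ[ℝ][X]) (q : ℍ[ℝ]) : ℍ[ℝ] := P.sum fun n a => q ^ n * a

/-- The regular power `(q - p)^{*n}`. Regular multiplication
`(∑ qⁿ aₙ) * (∑ qⁿ bₙ) = ∑ qⁿ ∑ₖ aₖ bₙ₋ₖ` is multiplication in `ℍ[X]`. -/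
def regPow (p : ℍ[ℝ]) (n : ℕ) (q : ℍ[ℝ]) : ℍ[ℝ] :=
  regEval ((Polynomial.X - Polynomial.C p) ^ n) q

/-- `f`, defined on `Ω`, is quaternionic analytic at `p`: on a (Euclidean) neighbourhood `U ⊆ Ω`
of `p` it is the sum of a convergent regular power series `∑ (q - p)^{*n} aₙ`. -/
def QuaternionicAnalyticAt (f : ℍ[ℝ] → ℍ[ℝ]) (Ω : Set ℍ[ℝ]) (p : ℍ[ℝ]) : Prop :=
  ∃ a : ℕ → ℍ[ℝ], ∃ U ∈ 𝓝 p, U ⊆ Ω ∧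
    ∀ q ∈ U, HasSum (fun n => regPow p n q * a n) (f q)

end SliceRegular

end

open scoped ComplexConjugate

noncomputable section

namespace SliceRegular

/-! Choose `R` with 2|Im p| < R < σ(p, ∂_σ Ω) and a line `L_I` through p. On the disc of radius R
about p in `L_I`, which lies in Ω, f has an ordinary Taylor expansion. The set ω(q,p) < R cuts every
line `L_J` in the same lens S, the intersection of the discs about c and `conj c`. S is connected
and symmetric and meets the real axis, so S ⊆ Ω on every line
(`sliceHom_mem_of_disjoint_sigmaBoundary`), and the identity principle determines f on `L_J` from f
on `L_I` (`eq_transport_of_isRegularOn`). Regular polynomials obey the same formula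
(`transport_regEval`), and (q - p)^{*n} is (z - c)^n on `L_I` (`regPow_sliceHom`), so the Taylor
series transports term by term. -/

theorem norm_eq_one_of_mem_imUnits {I : ℍ[ℝ]} (hI : I ∈ imUnits) : ‖I‖ = 1 := by
  have h : ‖I‖ ^ 2 = 1 := by
    rw [← norm_pow, show I ^ 2 = -1 from hI, norm_neg, norm_one]
  exact (pow_eq_one_iff_of_nonneg (norm_nonneg I) two_ne_zero).1 h

theorem re_eq_zero_of_mem_imUnits {I : ℍ[ℝ]} (hI : I ∈ imUnits) : I.re = 0 := by
  rw [← Quaternion.sq_eq_neg_normSq, Quaternion.normSq_eq_norm_mul_self,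
    norm_eq_one_of_mem_imUnits hI, show I ^ 2 = -1 from hI]
  simp

theorem mul_self_of_mem_imUnits {I : ℍ[ℝ]} (hI : I ∈ imUnits) : I * I = -1 := by
  rw [← sq]; exact hI

theorem im_eq_self_of_mem_imUnits {I : ℍ[ℝ]} (hI : I ∈ imUnits) : I.im = I := by
  have h := Quaternion.re_add_im I
  rw [re_eq_zero_of_mem_imUnits hI] at h
  simpa using h

/-- The embedding of `ℂ` onto the complex line `L_I`. -/
def sliceHom {I : ℍ[ℝ]} (hI : I ∈ imUnits) : ℂ →ₐ[ℝ] ℍ[ℝ] :=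
  Complex.lift ⟨I, mul_self_of_mem_imUnits hI⟩

variable {I J : ℍ[ℝ]} (hI : I ∈ imUnits) (hJ : J ∈ imUnits)

theorem sliceHom_apply (z : ℂ) : sliceHom hI z = slicePt I z.re z.im := by
  simp only [sliceHom, slicePt, Complex.lift_apply, Complex.liftAux_apply]
  rw [← Quaternion.coe_mul_eq_smul, Quaternion.coe_commutes]
  rfl

theorem sliceHom_eq (z : ℂ) : sliceHom hI z = (z.re : ℍ[ℝ]) + z.im • I := by
  simp only [sliceHom, Complex.lift_apply, Complex.liftAux_apply]
  rfl

theorem sliceHom_mem_complexLine (z : ℂ) : sliceHom hI z ∈ complexLine I :=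
  ⟨z.re, z.im, sliceHom_apply hI z⟩

@[simp] theorem re_sliceHom (z : ℂ) : (sliceHom hI z).re = z.re := by
  simp [sliceHom_eq, re_eq_zero_of_mem_imUnits hI]

@[simp] theorem im_sliceHom (z : ℂ) : (sliceHom hI z).im = z.im • I := by
  simp [sliceHom_eq, im_eq_self_of_mem_imUnits hI]

theorem norm_im_sliceHom (z : ℂ) : ‖(sliceHom hI z).im‖ = |z.im| := by
  rw [im_sliceHom, norm_smul, norm_eq_one_of_mem_imUnits hI, mul_one, Real.norm_eq_abs]

theorem norm_sq_eq_re_sq_add_norm_im_sq (q : ℍ[ℝ]) : ‖q‖ ^ 2 = q.re ^ 2 + ‖q.im‖ ^ 2 := by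
  simp only [sq, ← Quaternion.normSq_eq_norm_mul_self, Quaternion.normSq_def']
  simp; ring

@[simp] theorem norm_sliceHom (z : ℂ) : ‖sliceHom hI z‖ = ‖z‖ := by
  rw [← sq_eq_sq₀ (norm_nonneg _) (norm_nonneg _), norm_sq_eq_re_sq_add_norm_im_sq,
    re_sliceHom, norm_im_sliceHom, Complex.sq_norm, Complex.normSq_apply, sq_abs]
  ring

theorem continuous_sliceHom : Continuous (sliceHom hI) :=
  (sliceHom hI).toLinearMap.continuous_of_finiteDimensional

/-- Every quaternion lies on a complex line, in its closed upper half plane. -/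
theorem exists_eq_sliceHom (q : ℍ[ℝ]) :
    ∃ (I : ℍ[ℝ]) (hI : I ∈ imUnits) (z : ℂ), z.im = ‖q.im‖ ∧ z.re = q.re ∧ q = sliceHom hI z := by
  by_cases h : q.im = 0
  · have hi : ((Complex.I : ℂ) : ℍ[ℝ]) ∈ imUnits := by
      change ((Complex.I : ℂ) : ℍ[ℝ]) ^ 2 = -1
      rw [sq, ← Quaternion.coeComplex_mul, Complex.I_mul_I]
      ext <;> simp
    refine ⟨_, hi, ⟨q.re, 0⟩, by simp [h], rfl, ?_⟩
    rw [sliceHom_eq]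
    conv_lhs => rw [← Quaternion.re_add_im q, h]
    simp
  · have hn : ‖q.im‖ ≠ 0 := norm_ne_zero_iff.2 h
    have hu : ‖q.im‖⁻¹ • q.im ∈ imUnits := by
      simp only [imUnits, Set.mem_ofPred_eq, smul_pow, Quaternion.im_sq,
        Quaternion.normSq_eq_norm_mul_self]
      rw [smul_neg, ← Quaternion.coe_smul, smul_eq_mul]
      rw [show (‖q.im‖⁻¹ ^ 2 * (‖q.im‖ * ‖q.im‖)) = 1 by field_simp]
      simp
    refine ⟨_, hu, ⟨q.re, ‖q.im‖⟩, rfl, rfl, ?_⟩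
    rw [sliceHom_eq, smul_smul, mul_inv_cancel₀ hn, one_smul, Quaternion.re_add_im]

/-! ### Holomorphic functions on a complex line -/

/-- The complex structure on `ℍ` given by left multiplication by `I`. -/
@[reducible] def sliceModule : Module ℂ ℍ[ℝ] := Module.compHom _ (sliceHom hI).toRingHom

@[reducible] def sliceNormedSpace : NormedSpace ℂ ℍ[ℝ] :=
  { sliceModule hI with
    norm_smul_le := fun z q => by
      change ‖sliceHom hI z * q‖ ≤ _
      rw [norm_mul, norm_sliceHom] }

/-- `g` is real differentiable at `z` and satisfies the Cauchy-Riemann equation for left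
multiplication by `I`. -/
def SliceHolomorphicAt (I : ℍ[ℝ]) (g : ℂ → ℍ[ℝ]) (z : ℂ) : Prop :=
  ∃ L : ℂ →L[ℝ] ℍ[ℝ], HasFDerivAt g L z ∧ L Complex.I = I * L 1

/-- The Cauchy-Riemann equation says that the real differential is complex linear for left
multiplication by `I`. -/
theorem SliceHolomorphicAt.differentiableAt {g : ℂ → ℍ[ℝ]} {z : ℂ}
    (h : SliceHolomorphicAt I g z) :
    letI := sliceNormedSpace hI
    DifferentiableAt ℂ g z := by
  obtain ⟨L, hL, hLI⟩ := h
  let := sliceNormedSpace hI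
  have key : ∀ w : ℂ, L w = w • L 1 := by
    intro w
    change L w = sliceHom hI w * L 1
    have hw : w = w.re • (1 : ℂ) + w.im • Complex.I := by
      apply Complex.ext <;> simp
    conv_lhs => rw [hw]
    rw [map_add, map_smul, map_smul, hLI, sliceHom_eq, add_mul, Quaternion.coe_mul_eq_smul,
      smul_mul_assoc]
  have hd : HasDerivAt g (L 1) z := by
    rw [hasDerivAt_iff_isLittleO]
    refine hL.isLittleO.congr_left fun w => ?_
    rw [key]
  exact hd.differentiableAt

/-- Taylor expansion of a holomorphic function on a disc of a complex line. -/
theorem exists_hasSum_of_sliceHolomorphicAt {g : ℂ → ℍ[ℝ]} {c : ℂ} {R : ℝ}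
    (h : ∀ z ∈ Metric.ball c R, SliceHolomorphicAt I g z) :
    ∃ a : ℕ → ℍ[ℝ], ∀ z ∈ Metric.ball c R,
      HasSum (fun n => sliceHom hI ((z - c) ^ n) * a n) (g z) := by
  let := sliceNormedSpace hI
  have hd : DifferentiableOn ℂ g (Metric.ball c R) := fun z hz =>
    ((h z hz).differentiableAt hI).differentiableWithinAt
  refine ⟨fun n => ((n.factorial : ℂ)⁻¹) • iteratedDeriv n g c, fun z hz => ?_⟩
  refine (Complex.hasSum_taylorSeries_on_ball hd hz).congr_fun ?_
  intro n
  change ((z - c) ^ n) • ((n.factorial : ℂ)⁻¹) • iteratedDeriv n g c = _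
  rw [smul_comm]

/-- Identity principle on a complex line, from the real axis. -/
theorem eqOn_of_sliceHolomorphicAt {I : ℍ[ℝ]} (hI : I ∈ imUnits) {g₁ g₂ : ℂ → ℍ[ℝ]} {S : Set ℂ} (hS : IsOpen S)
    (hSc : IsPreconnected S) (h₁ : ∀ z ∈ S, SliceHolomorphicAt I g₁ z)
    (h₂ : ∀ z ∈ S, SliceHolomorphicAt I g₂ z) {x : ℝ} (hx : (x : ℂ) ∈ S)
    (heq : ∀ t : ℝ, (t : ℂ) ∈ S → g₁ t = g₂ t) : Set.EqOn g₁ g₂ S := by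
  let := sliceNormedSpace hI
  have d₁ : DifferentiableOn ℂ g₁ S := fun z hz =>
    ((h₁ z hz).differentiableAt hI).differentiableWithinAt
  have d₂ : DifferentiableOn ℂ g₂ S := fun z hz =>
    ((h₂ z hz).differentiableAt hI).differentiableWithinAt
  refine (d₁.analyticOnNhd hS).eqOn_of_preconnected_of_frequently_eq (d₂.analyticOnNhd hS) hSc hx ?_
  have ht : Filter.Tendsto (fun t : ℝ => (t : ℂ)) (𝓝[≠] x) (𝓝[≠] (x : ℂ)) :=
    Complex.continuous_ofReal.continuousAt.tendsto.inf
      (by simp)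
  refine ht.frequently (Filter.Eventually.frequently ?_)
  have : ∀ᶠ t : ℝ in 𝓝 x, (t : ℂ) ∈ S :=
    Complex.continuous_ofReal.continuousAt.eventually (hS.mem_nhds hx)
  exact (this.filter_mono nhdsWithin_le_nhds).mono fun t ht => heq t ht

theorem IsRegularOn.sliceHolomorphicAt {I : ℍ[ℝ]} (hI : I ∈ imUnits) {f : ℍ[ℝ] → ℍ[ℝ]} {Ω : Set ℍ[ℝ]} (hf : IsRegularOn f Ω)
    {z : ℂ} (hz : sliceHom hI z ∈ Ω) : SliceHolomorphicAt I (fun w => f (sliceHom hI w)) z := by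
  rw [sliceHom_apply] at hz
  obtain ⟨hd, hb⟩ := hf I hI z.re z.im hz
  obtain ⟨L, hL⟩ := hd
  refine ⟨L.comp (Complex.equivRealProdCLM : ℂ →L[ℝ] ℝ × ℝ), ?_, ?_⟩
  · have := HasFDerivAt.comp (f := Complex.equivRealProdCLM) z hL
      (Complex.equivRealProdCLM : ℂ →L[ℝ] ℝ × ℝ).hasFDerivAt
    refine this.congr_of_eventuallyEq (Filter.Eventually.of_forall fun w => ?_)
    simp [sliceHom_apply]
  · have hx : deriv (fun t : ℝ => f (slicePt I t z.im)) z.re = L (1, 0) :=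
      (HasFDerivAt.comp_hasDerivAt (f := fun t : ℝ => (t, z.im)) z.re hL
        ((hasDerivAt_id z.re).prodMk (hasDerivAt_const z.re z.im))).deriv
    have hy : deriv (fun t : ℝ => f (slicePt I z.re t)) z.im = L (0, 1) :=
      (HasFDerivAt.comp_hasDerivAt (f := fun t : ℝ => (z.re, t)) z.im hL
        ((hasDerivAt_const z.im z.re).prodMk (hasDerivAt_id z.im))).deriv
    rw [dbar, hx, hy] at hb
    have h0 : L (1, 0) + I * L (0, 1) = 0 := (smul_eq_zero.1 hb).resolve_left (by norm_num)
    have h1 : L (1, 0) = -(I * L (0, 1)) := eq_neg_of_add_eq_zero_left h0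
    simp [h1, ← mul_assoc, mul_self_of_mem_imUnits hI]

/-! ### The representation formula -/

/-- The right-hand side of the representation formula, which carries the values of a slice
function on `L_I` to its values on `L_J`. -/
def transport (I J : ℍ[ℝ]) (a b : ℍ[ℝ]) : ℍ[ℝ] :=
  (1 / 2 : ℝ) • (a + b - J * I * (a - b))

theorem SliceHolomorphicAt.transport {I J : ℍ[ℝ]} (hI : I ∈ imUnits) (hJ : J ∈ imUnits)
    {g : ℂ → ℍ[ℝ]} {z : ℂ} (h : SliceHolomorphicAt I g z)
    (h' : SliceHolomorphicAt I g (conj z)) :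
    SliceHolomorphicAt J (fun w => transport I J (g w) (g (conj w))) z := by
  obtain ⟨L, hL, hLI⟩ := h
  obtain ⟨M, hM, hMI⟩ := h'
  have hM' := HasFDerivAt.comp (f := fun w : ℂ => conj w) z hM
    (Complex.conjCLE : ℂ →L[ℝ] ℂ).hasFDerivAt
  refine ⟨_, ((hL.add hM').sub ((hL.sub hM').const_mul (J * I))).const_smul (1 / 2 : ℝ), ?_⟩
  have hI2 := mul_self_of_mem_imUnits hI
  have hJ2 := mul_self_of_mem_imUnits hJ
  -- Conjugation turns the differential `M` into one sending i to -I M(1), so sums and differences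
  -- of the two terms swap roles when i is applied; J(-JI) = I matches them again.
  have e1 : J * I * (I * L 1 + I * M 1) = - (J * (L 1 + M 1)) := by
    rw [← mul_add, mul_assoc, ← mul_assoc I, hI2, neg_one_mul, mul_neg]
  have e2 : J * (J * I * (L 1 - M 1)) = - (I * (L 1 - M 1)) := by
    rw [← mul_assoc, ← mul_assoc, hJ2]; simp
  simp [hLI, hMI, mul_sub J, mul_add J, e1, e2]
  simp only [mul_sub]
  module

theorem transport_sliceHom {I J : ℍ[ℝ]} (hI : I ∈ imUnits) (hJ : J ∈ imUnits) (w : ℂ) :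
    transport I J (sliceHom hI w) (sliceHom hI (conj w)) = sliceHom hJ w := by
  simp only [transport, sliceHom_eq, Complex.conj_re, Complex.conj_im]
  rw [show (w.re : ℍ[ℝ]) + w.im • I - (↑w.re + -w.im • I) = (2 * w.im) • I by module,
    mul_smul_comm, mul_assoc, mul_self_of_mem_imUnits hI,
    show (w.re : ℍ[ℝ]) + w.im • I + (↑w.re + -w.im • I) = (2 : ℝ) • ↑w.re by module, mul_neg_one]
  module

theorem transport_mul_right (a b c : ℍ[ℝ]) :
    transport I J (a * c) (b * c) = transport I J a b * c := by
  simp only [transport, smul_mul_assoc, sub_mul, add_mul, mul_assoc, mul_sub]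

theorem transport_self (a : ℍ[ℝ]) : transport I J a a = a := by
  simp only [transport, sub_self, mul_zero, sub_zero]
  module

theorem hasSum_transport {u v : ℕ → ℍ[ℝ]} {a b : ℍ[ℝ]} (hu : HasSum u a) (hv : HasSum v b) :
    HasSum (fun n => transport I J (u n) (v n)) (transport I J a b) :=
  ((hu.add hv).sub ((hu.sub hv).mul_left (J * I))).const_smul (1 / 2 : ℝ)

/-! ### Regular polynomials on complex lines -/

theorem regEval_add (P Q : ℍ[ℝ][X]) (q : ℍ[ℝ]) :
    regEval (P + Q) q = regEval P q + regEval Q q :=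
  Polynomial.sum_add_index P Q _ (by simp) (by simp [mul_add])

theorem regEval_monomial (n : ℕ) (a q : ℍ[ℝ]) :
    regEval (Polynomial.monomial n a) q = q ^ n * a :=
  Polynomial.sum_monomial_index a _ (by simp)

theorem transport_add (a b c d : ℍ[ℝ]) :
    transport I J (a + b) (c + d) = transport I J a c + transport I J b d := by
  simp only [transport, mul_sub, mul_add]
  module

/-- Transport is additive and commutes with right multiplication, so the coefficients play no role
and only powers of the variable matter. -/
theorem transport_regEval (P : ℍ[ℝ][X]) (z : ℂ) :
    transport I J (regEval P (sliceHom hI z)) (regEval P (sliceHom hI (conj z))) =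
      regEval P (sliceHom hJ z) := by
  induction P using Polynomial.induction_on' with
  | add P Q hP hQ => simp only [regEval_add, transport_add, hP, hQ]
  | monomial n a =>
    simp only [regEval_monomial, transport_mul_right, ← map_pow, transport_sliceHom hI hJ]

theorem regEval_map_sliceHom (P : ℂ[X]) (z : ℂ) :
    regEval (P.map (sliceHom hI).toRingHom) (sliceHom hI z) = sliceHom hI (P.eval z) := by
  induction P using Polynomial.induction_on' with
  | add P Q hP hQ => simp only [Polynomial.map_add, regEval_add, hP, hQ, Polynomial.eval_add, map_add]
  | monomial n a =>
    rw [Polynomial.map_monomial, regEval_monomial, Polynomial.eval_monomial, mul_comm a, map_mul,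
      map_pow]
    rfl

/-- The coefficients of X - p lie in the commutative field `L_I`, where the regular power is the
ordinary one. -/
theorem regPow_sliceHom (c z : ℂ) (n : ℕ) :
    regPow (sliceHom hI c) n (sliceHom hI z) = sliceHom hI ((z - c) ^ n) := by
  have h : (Polynomial.X - Polynomial.C (sliceHom hI c)) ^ n =
      ((Polynomial.X - Polynomial.C c) ^ n).map (sliceHom hI).toRingHom := by
    simp [Polynomial.map_pow]
  rw [regPow, h, regEval_map_sliceHom]
  simp

/-! ### The distances σ and ω, and the σ-boundary -/

theorem norm_sub_le_omegaDist (q p : ℍ[ℝ]) : ‖q - p‖ ≤ omegaDist q p := by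
  refine Real.le_sqrt_of_sq_le ?_
  rw [norm_sq_eq_re_sq_add_norm_im_sq, Quaternion.re_sub, Quaternion.im_sub]
  gcongr
  exact norm_sub_le _ _

theorem sigmaDist_le_omegaDist (q p : ℍ[ℝ]) : sigmaDist q p ≤ omegaDist q p := by
  unfold sigmaDist
  split_ifs
  exacts [norm_sub_le_omegaDist q p, le_rfl]

theorem sigmaDist_sliceHom (z w : ℂ) : sigmaDist (sliceHom hI z) (sliceHom hI w) = ‖z - w‖ := by
  rw [sigmaDist, if_pos ⟨I, hI, sliceHom_mem_complexLine hI z, sliceHom_mem_complexLine hI w⟩,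
    ← map_sub, norm_sliceHom]

theorem omegaDist_comm (q p : ℍ[ℝ]) : omegaDist q p = omegaDist p q := by
  unfold omegaDist
  congr 1
  ring

/-- A connected part of a complex line which meets `Ω` but not its `σ`-boundary lies in `Ω`. -/
theorem sliceHom_mem_of_disjoint_sigmaBoundary {Ω : Set ℍ[ℝ]} (hΩ : IsOpen Ω) {S : Set ℂ}
    (hS : IsPreconnected S) {z₀ : ℂ} (h₀ : z₀ ∈ S) (h₀' : sliceHom hI z₀ ∈ Ω)
    (hb : ∀ z ∈ S, sliceHom hI z ∉ sigmaBoundary Ω) {z : ℂ} (hz : z ∈ S) :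
    sliceHom hI z ∈ Ω := by
  refine hS.subset_of_closure_inter_subset (hΩ.preimage (continuous_sliceHom hI)) ⟨z₀, h₀, h₀'⟩
    ?_ hz
  rintro w ⟨hw, hwS⟩
  by_contra hwΩ
  -- A limit point outside Ω is not σ-interior, and it is in the σ-closure because σ is Euclidean on
  -- the line.
  refine hb w hwS ⟨?_, fun h => hwΩ (@interior_subset _ sigmaTopology _ _ h)⟩
  rw [@mem_closure_iff _ sigmaTopology]
  intro o ho hwo
  obtain ⟨ε, hε, hεo⟩ := ho _ hwo
  obtain ⟨v, hv, hd⟩ := Metric.mem_closure_iff.1 hw ε hε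
  refine ⟨sliceHom hI v, hεo ?_, hv⟩
  change sigmaDist _ _ < ε
  rwa [sigmaDist_sliceHom, ← dist_eq_norm, dist_comm]

/-- As Im c ≥ 0, ω is the larger of the distances from z to c and to its conjugate; the unit J does
not enter. -/
theorem omegaDist_sliceHom_lt_iff {I J : ℍ[ℝ]} (hI : I ∈ imUnits) (hJ : J ∈ imUnits) {c z : ℂ}
    (hc : 0 ≤ c.im) {R : ℝ} (hR : 0 < R) :
    omegaDist (sliceHom hJ z) (sliceHom hI c) < R ↔
      z ∈ Metric.ball c R ∩ Metric.ball (conj c) R := by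
  have hn : ∀ w : ℂ, ‖w‖ < R ↔ w.re ^ 2 + w.im ^ 2 < R ^ 2 := fun w => by
    rw [← sq_lt_sq₀ (norm_nonneg w) hR.le, Complex.sq_norm, Complex.normSq_apply, ← sq, ← sq]
  rw [Set.mem_inter_iff, mem_ball_iff_norm, mem_ball_iff_norm, hn, hn, omegaDist,
    Real.sqrt_lt' hR, re_sliceHom, re_sliceHom, norm_im_sliceHom, norm_im_sliceHom,
    abs_of_nonneg hc]
  simp only [Complex.sub_re, Complex.sub_im, Complex.conj_re, Complex.conj_im, sub_neg_eq_add]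
  constructor
  · intro h
    constructor <;> nlinarith [mul_nonneg hc (sub_nonneg.2 (le_abs_self z.im)),
      mul_nonneg hc (sub_nonneg.2 (neg_abs_le z.im)), sq_abs z.im]
  · rintro ⟨h₁, h₂⟩
    rcases abs_cases z.im with ⟨h, -⟩ | ⟨h, -⟩ <;> rw [h] <;> nlinarith

theorem sliceHom_ofReal (x : ℝ) : sliceHom hI (x : ℂ) = (x : ℍ[ℝ]) := by
  simp

/-- Representation formula on a part of `L_J` symmetric about and meeting the real axis. -/
theorem eq_transport_of_isRegularOn {I J : ℍ[ℝ]} (hI : I ∈ imUnits) (hJ : J ∈ imUnits)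
    {f : ℍ[ℝ] → ℍ[ℝ]} {Ω : Set ℍ[ℝ]} (hf : IsRegularOn f Ω) {S : Set ℂ} (hS : IsOpen S)
    (hSc : IsPreconnected S) (hconj : ∀ z ∈ S, conj z ∈ S) {x : ℝ} (hx : (x : ℂ) ∈ S)
    (hSI : ∀ z ∈ S, sliceHom hI z ∈ Ω) (hSJ : ∀ z ∈ S, sliceHom hJ z ∈ Ω) {z : ℂ} (hz : z ∈ S) :
    f (sliceHom hJ z) = transport I J (f (sliceHom hI z)) (f (sliceHom hI (conj z))) := by
  refine eqOn_of_sliceHolomorphicAt hJ (g₁ := fun z => f (sliceHom hJ z)) hS hSc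
    (fun w hw => hf.sliceHolomorphicAt hJ (hSJ w hw))
    (fun w hw => (hf.sliceHolomorphicAt hI (hSI w hw)).transport hI hJ
      (hf.sliceHolomorphicAt hI (hSI _ (hconj w hw)))) hx (fun t _ => ?_) hz
  -- On the real axis z equals its conjugate and all the lines coincide, so both sides agree.
  simp only [Complex.conj_ofReal, transport_self, sliceHom_ofReal]

theorem continuous_omegaDist_left (p : ℍ[ℝ]) : Continuous fun q => omegaDist q p := by
  unfold omegaDist
  have := Quaternion.continuous_re
  have := Quaternion.continuous_im
  fun_prop

/-- A finite radius strictly in between also covers an empty σ-boundary, at distance +∞. -/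
theorem exists_radius_of_mem_analyticitySet {Ω : Set ℍ[ℝ]} {p : ℍ[ℝ]} (hp : p ∈ analyticitySet Ω) :
    ∃ R : ℝ, 2 * ‖p.im‖ < R ∧ ∀ b ∈ sigmaBoundary Ω, R < sigmaDist p b := by
  obtain ⟨R, h₁, h₂⟩ := ENNReal.lt_iff_exists_nnreal_btwn.1 hp.2
  refine ⟨R, ?_, fun b hb => ?_⟩
  · rwa [← ENNReal.ofReal_coe_nnreal, ENNReal.ofReal_lt_ofReal_iff_of_nonneg (by positivity)] at h₁
  · have h := h₂.trans_le (iInf₂_le b hb)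
    rw [← ENNReal.ofReal_coe_nnreal, ENNReal.ofReal_lt_ofReal_iff_of_nonneg R.coe_nonneg] at h
    exact h

end SliceRegular

end

open SliceRegular in
theorem mainTheorem9 (Ω : Set (Quaternion ℝ)) (hΩo : IsOpen Ω) (hΩc : IsConnected Ω)
    (f : Quaternion ℝ → Quaternion ℝ) (hf : SliceRegular.IsRegularOn f Ω) :
    ∀ p ∈ SliceRegular.analyticitySet Ω, SliceRegular.QuaternionicAnalyticAt f Ω p := by
  intro p hp
  obtain ⟨R, hpR, hR⟩ := exists_radius_of_mem_analyticitySet hp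
  have hpΩ : p ∈ Ω := hp.1
  obtain ⟨I, hI, c, hcim, -, hpc⟩ := exists_eq_sliceHom p
  rw [← hcim] at hpR
  have hc : 0 ≤ c.im := hcim ▸ norm_nonneg _
  have hR0 : 0 < R := by linarith
  subst hpc
  have hball : ∀ z ∈ Metric.ball c R, sliceHom hI z ∈ Ω := fun z hz =>
    sliceHom_mem_of_disjoint_sigmaBoundary hI hΩo (convex_ball c R).isPreconnected
      (Metric.mem_ball_self hR0) hpΩ
      (fun w hw hb => by
        have h := hR _ hb
        rw [sigmaDist_sliceHom, ← dist_eq_norm] at h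
        exact lt_asymm h (Metric.mem_ball'.1 hw)) hz
  set S : Set ℂ := Metric.ball c R ∩ Metric.ball (conj c) R with hS
  have hconj : ∀ z ∈ S, conj z ∈ S := by
    rintro z ⟨h₁, h₂⟩
    rw [mem_ball_iff_norm] at h₁ h₂
    refine ⟨?_, ?_⟩ <;> rw [mem_ball_iff_norm, ← Complex.norm_conj, map_sub, Complex.conj_conj]
    · exact h₂
    · rwa [Complex.conj_conj]
  have hSc : IsPreconnected S := ((convex_ball c R).inter (convex_ball _ R)).isPreconnected
  have hx : (c.re : ℂ) ∈ S := by
    rw [hS, ← omegaDist_sliceHom_lt_iff hI hI hc hR0, omegaDist, norm_im_sliceHom,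
      norm_im_sliceHom, re_sliceHom, re_sliceHom, Real.sqrt_lt' hR0]
    simp only [Complex.ofReal_re, Complex.ofReal_im, abs_zero, sq_abs, zero_add, sub_self]
    nlinarith
  -- The real point of S lies in Ω because it also lies in the disc in `L_I`; σ ≤ ω keeps S off the
  -- σ-boundary.
  have hSΩ : ∀ {J : Quaternion ℝ} (hJ : J ∈ imUnits), ∀ z ∈ S, sliceHom hJ z ∈ Ω := by
    intro J hJ z hz
    refine sliceHom_mem_of_disjoint_sigmaBoundary hJ hΩo hSc hx ?_ (fun w hw hb => ?_) hz
    · rw [sliceHom_ofReal, ← sliceHom_ofReal hI]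
      exact hball _ hx.1
    · have h := (omegaDist_sliceHom_lt_iff hI hJ hc hR0).2 hw
      rw [omegaDist_comm] at h
      exact lt_asymm (hR _ hb) ((sigmaDist_le_omegaDist _ _).trans_lt h)
  obtain ⟨a, ha⟩ := exists_hasSum_of_sliceHolomorphicAt hI
    (fun z hz => hf.sliceHolomorphicAt hI (hball z hz))
  refine ⟨a, {q | omegaDist q (sliceHom hI c) < R}, ?_, ?_, ?_⟩
  · refine (isOpen_Iio.preimage (continuous_omegaDist_left _)).mem_nhds ?_
    change omegaDist _ _ < R
    rw [omegaDist, norm_im_sliceHom, abs_of_nonneg hc, Real.sqrt_lt' hR0]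
    nlinarith
  · intro q hq
    obtain ⟨J, hJ, z, -, -, rfl⟩ := exists_eq_sliceHom q
    exact hSΩ hJ z ((omegaDist_sliceHom_lt_iff hI hJ hc hR0).1 hq)
  · intro q hq
    obtain ⟨J, hJ, z, -, -, rfl⟩ := exists_eq_sliceHom q
    have hz : z ∈ S := (omegaDist_sliceHom_lt_iff hI hJ hc hR0).1 hq
    rw [eq_transport_of_isRegularOn hI hJ hf (Metric.isOpen_ball.inter Metric.isOpen_ball) hSc
      hconj hx (hSΩ hI) (hSΩ hJ) hz]
    refine (hasSum_transport (ha z hz.1) (ha (conj z) (hconj z hz).1)).congr_fun fun n => ?_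
    rw [transport_mul_right, ← regPow_sliceHom, ← regPow_sliceHom, regPow, regPow, regPow,
      transport_regEval hI hJ]
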